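/- Let $B_r=\{z\in\mathbb{C}: |z|<r\}$, let $Z\subset B_2$, and let $\mathcal F(Z)$ be the family of real-valued functions $u\in C^2(B_2)$ such that $\Delta u=0$ in $B_2$ and $\{z\in B_2: u(z)=0\}=Z$. Then there exists a constant $C_Z>0$, depending only on $Z$, such that for all $u,v\in\mathcal F(Z)$ the quotient $u/v$ extends from $B_2\setminus Z$ to a $C^\infty$ nowhere vanishing real-valued function $f$ on $B_2$ which satisfies $$\big|\nabla\log|f|\big|\le C_Z\quad\text{in } B_1 .$$ -/

import Mathlib

open scoped ContDiff Gradient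

/-- The family of real-valued functions that are `C²` and harmonic on the open disk
`{|z| < 2}` of `ℂ` and whose zero set in that disk is exactly `Z`.
(Only the values on the disk matter.) -/
def HarmonicWithZeros (Z : Set ℂ) : Set (ℂ → ℝ) :=
  {u | InnerProductSpace.HarmonicOnNhd u (Metric.ball (0 : ℂ) 2) ∧
    {z ∈ Metric.ball (0 : ℂ) 2 | u z = 0} = Z}

/-- `f` is a smooth nowhere vanishing function on the open disk `{|z| < 2}` that extends the
quotient `u / v`, which is defined off the common zero set `Z` of `u` and `v`. -/
structure IsSmoothNonvanishingExtension (Z : Set ℂ) (u v f : ℂ → ℝ) : Prop where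
  smooth : ContDiffOn ℝ ∞ f (Metric.ball (0 : ℂ) 2)
  ne_zero : ∀ z ∈ Metric.ball (0 : ℂ) 2, f z ≠ 0
  eq_div : ∀ z ∈ Metric.ball (0 : ℂ) 2 \ Z, f z = u z / v z

/-!
Let `u₀` be harmonic on `{|z| < 2}` with zero set `Z`, not identically zero, and let `z₀` be a point
of the disk. Every function `u` that vanishes exactly on `Z` is, near `z₀`, the product of a fixed
function `s` and of a smooth nonvanishing factor `q` whose logarithmic gradient is bounded by a
constant that depends on `u₀` and `z₀` only. Both conclusions follow: `u / v` is locally the quotient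
of two such factors, the local quotients agree because `Z` has empty interior, and finitely many of
these neighbourhoods cover `{|z| ≤ 1}`.

If `z₀ ∉ Z`, then `s = 1` and the bound is Harnack's inequality (`norm_deriv_le_of_im_ne_zero`).

If `z₀ ∈ Z`, then `s = u₀`. Write `u₀ = Im F` with `F z₀ = 0` and choose a local coordinate `t` with
`F = t ^ k` (`exists_pow_coordinate`), so that `Z` becomes `2 k` equally spaced rays. Write
`u = Im H`. The function `H` is real on these rays, hence symmetric under the reflections in them and
invariant under the rotation by `2 π / k`, so that `H = g ∘ F` with `g` holomorphic near `0`
(`exists_comp_pow`); the disk on which `g` is defined is the same for all `u`. Now `Im g` vanishes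
exactly on the real axis, so `g` or `-g` is typically real. Rogosinski's argument (`norm_dslope_le`)
bounds `g` by a multiple of `|g' 0|` on a smaller disk, and Cauchy's estimates do the same for
`g''`. Hence the factor `q = Im g / Im`, composed with `F`, is smooth across the real axis (it is an
average of `Re g'`, see `imQuot`), is comparable with `|g' 0|` near `0`, and has gradient at most a
multiple of `|g' 0|` (`exists_imQuot_bound`).
-/

namespace HarmonicRatio

open Set Metric Filter Topology MeasureTheory

/-! ### Smoothness of parameter integrals -/

/-- An interval integral depends smoothly on a parameter if the integrand is jointly smooth. The
integral is the value at `0` of the convolution of the indicator of `(a, b]` with the reflected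
integrand, cut off by a bump function that equals `1` on `[a, b]`. -/
theorem contDiffOn_intervalIntegral {E : Type*} [NormedAddCommGroup E] [NormedSpace ℝ E]
    {Φ : E × ℝ → ℝ} {s : Set E} (hs : IsOpen s) (hΦ : ContDiffOn ℝ ∞ Φ (s ×ˢ univ))
    {a b : ℝ} (hab : a ≤ b) :
    ContDiffOn ℝ ∞ (fun p ↦ ∫ t in a..b, Φ (p, t)) s := by
  let χ : ContDiffBump (0 : ℝ) :=
    ⟨|a| + |b| + 1, |a| + |b| + 2, by positivity, by linarith⟩
  have h := contDiffOn_convolution_right_with_param_comp (μ := (volume : Measure ℝ)) (n := ⊤)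
    (ContinuousLinearMap.lsmul ℝ ℝ) (s := s) (v := fun _ ↦ (0 : ℝ)) contDiffOn_const
    (f := (Ioc a b).indicator fun _ ↦ (1 : ℝ)) (g := fun p x ↦ χ x * Φ (p, -x))
    (k := closedBall 0 (|a| + |b| + 2)) hs (isCompact_closedBall _ _) ?_ ?_ ?_
  · refine h.congr fun p hp ↦ ?_
    rw [convolution_def, intervalIntegral.integral_of_le hab, ← integral_indicator measurableSet_Ioc]
    congr 1
    ext t
    by_cases ht : t ∈ Ioc a b
    · have : χ (-t) = 1 := by
        apply χ.one_of_mem_closedBall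
        rw [mem_closedBall_zero_iff, norm_neg, Real.norm_eq_abs, abs_le]
        change -(|a| + |b| + 1) ≤ t ∧ t ≤ |a| + |b| + 1
        constructor <;>
          linarith [ht.1, ht.2, neg_abs_le a, le_abs_self b, abs_nonneg a, abs_nonneg b]
      simp [ht, this]
    · simp [ht]
  · intro p x _ hx
    have : χ x = 0 := by
      apply χ.zero_of_le_dist
      rw [mem_closedBall, not_le] at hx
      exact hx.le
    simp [this]
  · exact ((integrable_indicator_iff measurableSet_Ioc).2 (by simp)).locallyIntegrable
  · apply ContDiffOn.mul
    · exact (χ.contDiff.comp contDiff_snd).contDiffOn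
    · refine hΦ.comp (contDiff_fst.prodMk contDiff_snd.neg).contDiffOn ?_
      rintro ⟨p, x⟩ ⟨hp, -⟩
      exact ⟨hp, mem_univ _⟩

/-! ### Holomorphic functions with nonnegative real part -/

/-- Carathéodory's inequality at half the radius, from the Borel–Carathéodory theorem for `-P` with
an arbitrarily small bound on the real part. -/
theorem norm_le_three_mul_of_re_nonneg {P : ℂ → ℂ} {R : ℝ} (hR : 0 < R)
    (hP : DifferentiableOn ℂ P (ball 0 R)) (hre : ∀ z ∈ ball 0 R, 0 ≤ (P z).re)
    {z : ℂ} (hz : ‖z‖ ≤ R / 2) : ‖P z‖ ≤ 3 * ‖P 0‖ := by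
  refine le_of_forall_pos_le_add fun ε hε ↦ ?_
  have hzR : 0 < R - ‖z‖ := by linarith
  have h := Complex.borelCaratheodory (f := fun z ↦ - P z) (M := ε / 2) (z := z) (by positivity)
    hP.neg (fun w hw ↦ by simpa using by linarith [hre w hw]) hR
    (by rw [mem_ball_zero_iff]; linarith)
  rw [norm_neg, norm_neg] at h
  refine h.trans ?_
  have h1 : 2 * (ε / 2) * ‖z‖ / (R - ‖z‖) ≤ ε := by
    rw [div_le_iff₀ hzR]; nlinarith
  have h2 : ‖P 0‖ * (R + ‖z‖) / (R - ‖z‖) ≤ 3 * ‖P 0‖ := by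
    rw [div_le_iff₀ hzR]; nlinarith [norm_nonneg (P 0)]
  linarith

/-- The minimum principle for `Re P`, that is, the maximum principle for `exp (-P)`. -/
theorem re_nonneg_of_forall_sphere {P : ℂ → ℂ} {R : ℝ} (hR : 0 < R)
    (hP : DiffContOnCl ℂ P (ball 0 R)) (hre : ∀ z ∈ sphere 0 R, 0 ≤ (P z).re)
    {z : ℂ} (hz : z ∈ ball 0 R) : 0 ≤ (P z).re := by
  have h := Complex.norm_le_of_forall_mem_frontier_norm_le (f := fun z ↦ Complex.exp (-P z)) (C := 1)
    (isBounded_ball (x := (0 : ℂ)) (r := R)) ?_ ?_ (subset_closure hz)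
  · simpa [Complex.norm_exp] using h
  · exact (Complex.differentiable_exp (𝕜 := ℂ)).comp_diffContOnCl hP.neg
  · intro w hw
    rw [frontier_ball _ hR.ne'] at hw
    simpa [Complex.norm_exp] using hre w hw

/-! ### Typically real functions -/

/-- Rogosinski's bound for typically real functions, those with `Im g` of the sign of `Im z`. On
`|z| = ρ` one has `(ρ² - z²) / z = conj z - z = -2 i Im z`, so `(ρ² - z²) (g z - g 0) / z` has
nonnegative real part there, hence in the disk, and is therefore controlled by its value at `0`. -/
theorem norm_dslope_le {g : ℂ → ℂ} {ρ : ℝ} (hρ : 0 < ρ)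
    (hg : DifferentiableOn ℂ g (ball 0 (2 * ρ))) (h0 : (g 0).im = 0)
    (hpos : ∀ z ∈ ball (0 : ℂ) (2 * ρ), 0 ≤ z.im * (g z).im) {z : ℂ} (hz : ‖z‖ ≤ ρ / 2) :
    ‖dslope g 0 z‖ ≤ 4 * ‖deriv g 0‖ := by
  set P : ℂ → ℂ := fun z ↦ ((ρ : ℂ) ^ 2 - z ^ 2) * dslope g 0 z with hPdef
  have hd : DifferentiableOn ℂ (dslope g 0) (ball 0 (2 * ρ)) :=
    (Complex.differentiableOn_dslope (ball_mem_nhds _ (by positivity))).2 hg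
  have hP : DifferentiableOn ℂ P (ball 0 (2 * ρ)) := by
    apply DifferentiableOn.mul _ hd
    fun_prop
  have hcl : closure (ball (0 : ℂ) ρ) ⊆ ball 0 (2 * ρ) :=
    closure_ball_subset_closedBall.trans (closedBall_subset_ball (by linarith))
  have hre : ∀ w ∈ ball (0 : ℂ) ρ, 0 ≤ (P w).re := by
    intro w hw
    refine re_nonneg_of_forall_sphere hρ (hP.mono hcl).diffContOnCl (fun z hz ↦ ?_) hw
    rw [mem_sphere_zero_iff_norm] at hz
    have hz0 : z ≠ 0 := by rintro rfl; simp at hz; linarith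
    have hzz : (ρ : ℂ) ^ 2 = z * (starRingEnd ℂ) z := by
      rw [Complex.mul_conj, Complex.normSq_eq_norm_sq, hz]; push_cast; rfl
    have : P z = ((starRingEnd ℂ) z - z) * (g z - g 0) := by
      simp only [hPdef]
      rw [dslope_of_ne _ hz0, slope_def_field, hzz]
      field_simp
      ring
    rw [this]
    have h1 := hpos z (by rw [mem_ball_zero_iff]; linarith)
    simp only [Complex.mul_re, Complex.sub_re, Complex.conj_re, Complex.sub_im, Complex.conj_im, h0]
    linarith
  have h := norm_le_three_mul_of_re_nonneg hρ (hP.mono (ball_subset_ball (by linarith))) hre hz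
  simp only [hPdef, norm_mul, dslope_same] at h
  have h1 : 3 / 4 * ρ ^ 2 ≤ ‖(ρ : ℂ) ^ 2 - z ^ 2‖ := by
    have := norm_sub_norm_le ((ρ : ℂ) ^ 2) (z ^ 2)
    rw [norm_pow, norm_pow, Complex.norm_real, Real.norm_of_nonneg hρ.le] at this
    nlinarith [norm_nonneg z]
  have h2 : ‖(ρ : ℂ) ^ 2 - 0 ^ 2‖ = ρ ^ 2 := by
    simp
  rw [h2] at h
  have h3 : 3 / 4 * ρ ^ 2 * ‖dslope g 0 z‖ ≤ 3 / 4 * ρ ^ 2 * (4 * ‖deriv g 0‖) := by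
    calc _ ≤ _ := mul_le_mul_of_nonneg_right h1 (norm_nonneg _)
      _ ≤ _ := h
      _ = _ := by ring
  exact le_of_mul_le_mul_left h3 (by positivity)

/-- Cauchy's estimates turn Rogosinski's bound into a Lipschitz bound for `g'` that is linear in
`|g' 0|`: they are applied to `g - g 0` on circles of radius `ρ / 8`, and then to `g'`. -/
theorem norm_deriv_sub_deriv_le {g : ℂ → ℂ} {ρ : ℝ} (hρ : 0 < ρ)
    (hg : DifferentiableOn ℂ g (ball 0 (2 * ρ))) (h0 : (g 0).im = 0)
    (hpos : ∀ z ∈ ball (0 : ℂ) (2 * ρ), 0 ≤ z.im * (g z).im) {z w : ℂ}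
    (hz : z ∈ ball (0 : ℂ) (ρ / 4)) (hw : w ∈ ball (0 : ℂ) (ρ / 4)) :
    ‖deriv g z - deriv g w‖ ≤ 128 * ‖deriv g 0‖ / ρ * ‖z - w‖ := by
  have hgd : DifferentiableOn ℂ (deriv g) (ball 0 (2 * ρ)) := hg.deriv isOpen_ball
  have hb : ∀ z : ℂ, ‖z‖ ≤ ρ / 2 → ‖g z - g 0‖ ≤ 2 * ρ * ‖deriv g 0‖ := by
    intro z hz
    have h := norm_dslope_le hρ hg h0 hpos hz
    have h1 : g z - g 0 = z * dslope g 0 z := by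
      have := sub_smul_dslope g 0 z
      simpa using this.symm
    rw [h1, norm_mul]
    calc _ ≤ ρ / 2 * (4 * ‖deriv g 0‖) := by gcongr
      _ = _ := by ring
  have hb1 : ∀ z : ℂ, ‖z‖ ≤ 3 * ρ / 8 → ‖deriv g z‖ ≤ 16 * ‖deriv g 0‖ := by
    intro z hz
    have h := Complex.norm_deriv_le_of_forall_mem_sphere_norm_le (c := z) (R := ρ / 8)
      (C := 2 * ρ * ‖deriv g 0‖) (f := fun z ↦ g z - g 0) (by positivity) ?_ ?_
    · rw [deriv_sub_const] at h
      refine h.trans_eq ?_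
      field_simp
      ring
    · refine (DifferentiableOn.sub_const ?_ _).diffContOnCl
      refine hg.mono (closure_ball_subset_closedBall.trans fun x hx ↦ ?_)
      rw [mem_closedBall, dist_eq_norm] at hx
      rw [mem_ball_zero_iff]
      linarith [norm_le_norm_sub_add x z]
    · intro x hx
      rw [mem_sphere, dist_eq_norm] at hx
      apply hb
      linarith [norm_le_norm_sub_add x z]
  have hb2 : ∀ z ∈ ball (0 : ℂ) (ρ / 4), ‖deriv (deriv g) z‖ ≤ 128 * ‖deriv g 0‖ / ρ := by
    intro z hz
    rw [mem_ball_zero_iff] at hz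
    have h := Complex.norm_deriv_le_of_forall_mem_sphere_norm_le (c := z) (R := ρ / 8)
      (C := 16 * ‖deriv g 0‖) (f := deriv g) (by positivity) ?_ ?_
    · refine h.trans_eq ?_
      field_simp
      ring
    · refine DifferentiableOn.diffContOnCl ?_
      refine hgd.mono (closure_ball_subset_closedBall.trans fun x hx ↦ ?_)
      rw [mem_closedBall, dist_eq_norm] at hx
      rw [mem_ball_zero_iff]
      linarith [norm_le_norm_sub_add x z]
    · intro x hx
      rw [mem_sphere, dist_eq_norm] at hx
      apply hb1
      linarith [norm_le_norm_sub_add x z]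
  exact (convex_ball _ _).norm_image_sub_le_of_norm_deriv_le
    (fun x hx ↦ hgd.differentiableAt (isOpen_ball.mem_nhds
      (ball_subset_ball (by linarith) hx))) hb2 hw hz

/-! ### The quotient of `Im g` by `Im z` -/

/-- The point over `re z` whose height is that of `z` scaled by `sin t`. -/
noncomputable def squeeze (z : ℂ) (t : ℝ) : ℂ := z.re + z.im * Real.sin t * Complex.I

theorem squeeze_eq (z : ℂ) (t : ℝ) : squeeze z t = ⟨z.re, z.im * Real.sin t⟩ := by
  apply Complex.ext <;> simp [squeeze, -Complex.ofReal_sin]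

theorem norm_squeeze_le (z : ℂ) (t : ℝ) : ‖squeeze z t‖ ≤ ‖z‖ := by
  rw [← sq_le_sq₀ (norm_nonneg _) (norm_nonneg _), ← Complex.normSq_eq_norm_sq,
    ← Complex.normSq_eq_norm_sq, squeeze_eq, Complex.normSq_mk, Complex.normSq_apply]
  nlinarith [Real.sin_sq_add_cos_sq t, mul_nonneg (sq_nonneg z.im) (sq_nonneg (Real.cos t))]

theorem squeeze_sub (z w : ℂ) (t : ℝ) : squeeze (z - w) t = squeeze z t - squeeze w t := by
  simp only [squeeze, Complex.sub_re, Complex.sub_im]; push_cast; ring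

theorem squeeze_mem_ball {z : ℂ} {R : ℝ} (hz : z ∈ ball (0 : ℂ) R) (t : ℝ) :
    squeeze z t ∈ ball (0 : ℂ) R := by
  rw [mem_ball_zero_iff] at *
  exact (norm_squeeze_le z t).trans_lt hz

theorem contDiff_squeeze : ContDiff ℝ ∞ (fun p : ℂ × ℝ ↦ squeeze p.1 p.2) := by
  unfold squeeze
  have h1 : ContDiff ℝ ∞ (fun p : ℂ × ℝ ↦ (p.1.re : ℂ)) :=
    (Complex.ofRealCLM.comp Complex.reCLM).contDiff.comp contDiff_fst
  have h2 : ContDiff ℝ ∞ (fun p : ℂ × ℝ ↦ (p.1.im : ℂ)) :=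
    (Complex.ofRealCLM.comp Complex.imCLM).contDiff.comp contDiff_fst
  have h3 : ContDiff ℝ ∞ (fun p : ℂ × ℝ ↦ (Real.sin p.2 : ℂ)) :=
    Complex.ofRealCLM.contDiff.comp (Real.contDiff_sin.comp contDiff_snd)
  exact h1.add ((h2.mul h3).mul contDiff_const)

/-- The quotient `Im g z / Im z`, for `g` real on the real axis, written so as to make sense on the
axis too: it is the average of `Re g'` over the vertical segment from `re z` to `z`. The segment is
parametrized by `sin t` so that the integrand is smooth for all real `t`. -/
noncomputable def imQuot (g : ℂ → ℂ) (z : ℂ) : ℝ :=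
  ∫ t in (0 : ℝ)..Real.pi / 2, Real.cos t * (deriv g (squeeze z t)).re

theorem contDiffOn_imQuot_integrand {g : ℂ → ℂ} {R : ℝ} (hg : DifferentiableOn ℂ g (ball 0 R)) :
    ContDiffOn ℝ ∞ (fun p : ℂ × ℝ ↦ Real.cos p.2 * (deriv g (squeeze p.1 p.2)).re)
      (ball 0 R ×ˢ univ) := by
  have h1 : ContDiffOn ℝ ∞ (deriv g) (ball 0 R) :=
    ((hg.deriv isOpen_ball).contDiffOn isOpen_ball).restrict_scalars ℝ
  have h2 : ContDiffOn ℝ ∞ (fun p : ℂ × ℝ ↦ deriv g (squeeze p.1 p.2)) (ball 0 R ×ˢ univ) :=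
    h1.comp contDiff_squeeze.contDiffOn fun p hp ↦ squeeze_mem_ball hp.1 _
  exact (Real.contDiff_cos.comp contDiff_snd).contDiffOn.mul
    (Complex.reCLM.contDiff.comp_contDiffOn h2)

theorem contDiffOn_imQuot {g : ℂ → ℂ} {R : ℝ} (hg : DifferentiableOn ℂ g (ball 0 R)) :
    ContDiffOn ℝ ∞ (imQuot g) (ball 0 R) :=
  contDiffOn_intervalIntegral isOpen_ball (contDiffOn_imQuot_integrand hg) (by positivity)

theorem continuous_imQuot_integrand {g : ℂ → ℂ} {R : ℝ} (hg : DifferentiableOn ℂ g (ball 0 R))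
    {z : ℂ} (hz : z ∈ ball (0 : ℂ) R) :
    Continuous (fun t : ℝ ↦ Real.cos t * (deriv g (squeeze z t)).re) :=
  (contDiffOn_imQuot_integrand hg).continuousOn.comp_continuous (by fun_prop : Continuous
    fun t : ℝ ↦ (z, t)) fun t ↦ ⟨hz, mem_univ _⟩

theorem im_eq_imQuot_mul_im {g : ℂ → ℂ} {R : ℝ} (hg : DifferentiableOn ℂ g (ball 0 R))
    (hreal : ∀ z ∈ ball (0 : ℂ) R, z.im = 0 → (g z).im = 0) {z : ℂ} (hz : z ∈ ball (0 : ℂ) R) :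
    (g z).im = imQuot g z * z.im := by
  have hder : ∀ t : ℝ, HasDerivAt (fun t : ℝ ↦ (g (squeeze z t)).im)
      (Real.cos t * (deriv g (squeeze z t)).re * z.im) t := by
    intro t
    have h1 : HasDerivAt g (deriv g (squeeze z t)) (squeeze z t) :=
      (hg.differentiableAt (isOpen_ball.mem_nhds (squeeze_mem_ball hz t))).hasDerivAt
    have h2 : HasDerivAt (fun t : ℝ ↦ squeeze z t) (z.im * (Real.cos t) * Complex.I) t := by
      unfold squeeze
      exact (((Real.hasDerivAt_sin t).ofReal_comp.const_mul (z.im : ℂ)).mul_const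
        Complex.I).const_add _
    have h3 := h1.comp t h2
    have h4 := Complex.imCLM.hasFDerivAt.comp_hasDerivAt t h3
    convert! h4 using 1
    simp [-Complex.ofReal_cos]
    ring
  have h := intervalIntegral.integral_eq_sub_of_hasDerivAt (a := 0) (b := Real.pi / 2)
    (fun t _ ↦ hder t) (((continuous_imQuot_integrand hg hz).mul
      continuous_const).intervalIntegrable _ _)
  rw [intervalIntegral.integral_mul_const] at h
  have h1 : squeeze z (Real.pi / 2) = z := by rw [squeeze_eq]; simp
  have h0 : (g (squeeze z 0)).im = 0 :=
    hreal _ (squeeze_mem_ball hz 0) (by rw [squeeze_eq]; simp)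
  rw [h1, h0, sub_zero] at h
  exact h.symm

/-- The Schwarz reflection principle: a holomorphic function on a disk that is real on the real
diameter commutes with conjugation. -/
theorem conj_apply_conj {g : ℂ → ℂ} {R : ℝ} (hR : 0 < R) (hg : DifferentiableOn ℂ g (ball 0 R))
    (hreal : ∀ z ∈ ball (0 : ℂ) R, z.im = 0 → (g z).im = 0) {z : ℂ} (hz : z ∈ ball (0 : ℂ) R) :
    (starRingEnd ℂ) (g ((starRingEnd ℂ) z)) = g z := by
  have hconj : ∀ w ∈ ball (0 : ℂ) R, (starRingEnd ℂ) w ∈ ball (0 : ℂ) R := fun w hw ↦ by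
    rw [mem_ball_zero_iff] at *; rwa [RCLike.norm_conj]
  have h1 : AnalyticOnNhd ℂ (starRingEnd ℂ ∘ g ∘ starRingEnd ℂ) (ball 0 R) := by
    apply DifferentiableOn.analyticOnNhd _ isOpen_ball
    intro w hw
    refine DifferentiableAt.differentiableWithinAt (differentiableAt_conj_conj_iff.2 ?_)
    exact hg.differentiableAt (isOpen_ball.mem_nhds (hconj w hw))
  refine h1.eqOn_of_preconnected_of_frequently_eq (hg.analyticOnNhd isOpen_ball)
    (convex_ball _ _).isPreconnected (mem_ball_self hR) ?_ hz
  have htend : Tendsto (fun x : ℝ ↦ (x : ℂ)) (𝓝[≠] 0) (𝓝[≠] 0) := by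
    refine tendsto_nhdsWithin_iff.2 ⟨?_, ?_⟩
    · exact (Complex.continuous_ofReal.tendsto' 0 0 (by simp)).mono_left nhdsWithin_le_nhds
    · filter_upwards [self_mem_nhdsWithin] with x hx
      simpa using hx
  refine htend.frequently (Eventually.frequently ?_)
  filter_upwards [nhdsWithin_le_nhds (ball_mem_nhds (0 : ℝ) hR)] with x hx
  have hx' : (x : ℂ) ∈ ball (0 : ℂ) R := by simpa using hx
  simp only [Function.comp_apply, Complex.conj_ofReal]
  exact Complex.conj_eq_iff_im.2 (hreal _ hx' (by simp))

/-- If `Im g` vanishes exactly on the real diameter, then `g` or `-g` is typically real: `Im g` has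
constant sign on the upper half disk, and the opposite one on its mirror image. -/
theorem sign_im_mul_im {g : ℂ → ℂ} {R : ℝ} (hR : 0 < R) (hg : DifferentiableOn ℂ g (ball 0 R))
    (hzero : ∀ z ∈ ball (0 : ℂ) R, (g z).im = 0 ↔ z.im = 0) :
    (∀ z ∈ ball (0 : ℂ) R, 0 ≤ z.im * (g z).im) ∨
      ∀ z ∈ ball (0 : ℂ) R, 0 ≤ z.im * (-g z).im := by
  set U : Set ℂ := ball 0 R ∩ {z | 0 < z.im} with hU
  have hUc : IsPreconnected U :=
    ((convex_ball _ _).inter (convex_halfSpace_im_gt 0)).isPreconnected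
  have key : ∀ G : ℂ → ℂ, DifferentiableOn ℂ G (ball 0 R) →
      (∀ z ∈ ball (0 : ℂ) R, (G z).im = 0 ↔ z.im = 0) →
      0 < (G (R / 2 * Complex.I)).im → ∀ z ∈ ball (0 : ℂ) R, 0 ≤ z.im * (G z).im := by
    intro G hG hG0 hp
    have hcont : ContinuousOn (fun z ↦ (G z).im) U :=
      Complex.continuous_im.comp_continuousOn (hG.continuousOn.mono inter_subset_left)
    have hpU : (R / 2 * Complex.I : ℂ) ∈ U := by
      refine ⟨?_, by simpa⟩
      rw [mem_ball_zero_iff]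
      simp [abs_of_pos hR, hR]
    have hup : ∀ z ∈ U, 0 < (G z).im := by
      intro z hz
      by_contra! hle
      obtain ⟨w, hw, hw0⟩ := hUc.intermediate_value hz hpU hcont ⟨hle, hp.le⟩
      exact hw.2.ne' ((hG0 w hw.1).1 hw0)
    intro z hz
    rcases lt_trichotomy z.im 0 with h | h | h
    · have hc := conj_apply_conj hR hG (fun z hz ↦ (hG0 z hz).2) hz
      have hz' : (starRingEnd ℂ) z ∈ U := by
        refine ⟨?_, by simpa using h⟩
        rw [mem_ball_zero_iff] at *; rwa [RCLike.norm_conj]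
      have := hup _ hz'
      rw [← hc, Complex.conj_im]
      nlinarith
    · simp [h]
    · exact (mul_pos h (hup z ⟨hz, h⟩)).le
  have hpb : (R / 2 * Complex.I : ℂ) ∈ ball (0 : ℂ) R := by
    rw [mem_ball_zero_iff]
    simp [abs_of_pos hR, hR]
  have hp0 : (g (R / 2 * Complex.I)).im ≠ 0 := by
    rw [Ne, hzero _ hpb]
    simp [hR.ne']
  rcases hp0.lt_or_gt with h | h
  · exact Or.inr (key (fun z ↦ -g z) hg.neg (by simpa using hzero) (by simpa using h))
  · exact Or.inl (key g hg hzero h)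

theorem deriv_im_eq_zero {g : ℂ → ℂ} {R : ℝ} (hR : 0 < R) (hg : DifferentiableOn ℂ g (ball 0 R))
    (hreal : ∀ z ∈ ball (0 : ℂ) R, z.im = 0 → (g z).im = 0) : (deriv g 0).im = 0 := by
  have h1 : HasDerivAt g (deriv g 0) ((0 : ℝ) : ℂ) :=
    (hg.differentiableAt (ball_mem_nhds _ hR)).hasDerivAt
  have h2 := Complex.imCLM.hasFDerivAt.comp_hasDerivAt (0 : ℝ) h1.comp_ofReal
  have h3 : HasDerivAt (fun _ : ℝ ↦ (0 : ℝ)) (deriv g 0).im 0 := by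
    refine h2.congr_of_eventuallyEq ?_
    filter_upwards [ball_mem_nhds (0 : ℝ) hR] with x hx
    exact (hreal x (by simpa using hx) (by simp)).symm
  exact h3.unique (hasDerivAt_const _ _)

theorem imQuot_zero (g : ℂ → ℂ) : imQuot g 0 = (deriv g 0).re := by
  simp [imQuot, squeeze]

/-- The gradient estimate for the model zero set, a diameter of a disk: `δ` and `C` do not depend on
`g`. The value of the quotient at `0` is `g' 0`, and its Lipschitz constant is at most a multiple of
`|g' 0|`, so that near `0` the quotient stays comparable with `|g' 0|`. -/
theorem exists_imQuot_bound {R : ℝ} (hR : 0 < R) :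
    ∃ δ > 0, ∃ C : ℝ, ∀ g : ℂ → ℂ, DifferentiableOn ℂ g (ball 0 R) →
      (∀ z ∈ ball (0 : ℂ) R, (g z).im = 0 ↔ z.im = 0) →
      ContDiffOn ℝ ∞ (imQuot g) (ball 0 δ) ∧
      ∀ z ∈ ball (0 : ℂ) δ, (g z).im = imQuot g z * z.im ∧ imQuot g z ≠ 0 ∧
        ‖fderiv ℝ (imQuot g) z‖ ≤ C * |imQuot g z| := by
  obtain ⟨ρ, rfl⟩ : ∃ ρ, R = 2 * ρ := ⟨R / 2, by ring⟩
  have hρ : 0 < ρ := by linarith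
  -- the quotient has Lipschitz constant `256 |g' 0| / ρ`, so it stays above `|g' 0| / 2` on this disk
  refine ⟨ρ / 512, by positivity, 512 / ρ, fun g hg hzero ↦ ?_⟩
  have hreal : ∀ z ∈ ball (0 : ℂ) (2 * ρ), z.im = 0 → (g z).im = 0 := fun z hz ↦ (hzero z hz).2
  have h0 : (g 0).im = 0 := hreal 0 (mem_ball_self hR) (by simp)
  set a := ‖deriv g 0‖ with ha
  have hLd : ∀ z ∈ ball (0 : ℂ) (ρ / 4), ∀ w ∈ ball (0 : ℂ) (ρ / 4),
      ‖deriv g z - deriv g w‖ ≤ 128 * a / ρ * ‖z - w‖ := by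
    intro z hz w hw
    rcases sign_im_mul_im hR hg hzero with h | h
    · exact norm_deriv_sub_deriv_le hρ hg h0 h hz hw
    · have := norm_deriv_sub_deriv_le (g := fun z ↦ -g z) hρ hg.neg (by simpa using h0) h hz hw
      rwa [deriv.fun_neg, deriv.fun_neg, deriv.fun_neg, norm_neg, ← neg_sub', norm_neg] at this
  have hLq : ∀ z ∈ ball (0 : ℂ) (ρ / 4), ∀ w ∈ ball (0 : ℂ) (ρ / 4),
      |imQuot g z - imQuot g w| ≤ 256 * a / ρ * ‖z - w‖ := by
    intro z hz w hw
    have hz' := ball_subset_ball (by linarith : ρ / 4 ≤ 2 * ρ) hz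
    have hw' := ball_subset_ball (by linarith : ρ / 4 ≤ 2 * ρ) hw
    rw [imQuot, imQuot, ← Real.norm_eq_abs, ← intervalIntegral.integral_sub
      ((continuous_imQuot_integrand hg hz').intervalIntegrable _ _)
      ((continuous_imQuot_integrand hg hw').intervalIntegrable _ _)]
    refine (intervalIntegral.norm_integral_le_of_norm_le_const
      (C := 128 * a / ρ * ‖z - w‖) fun t _ ↦ ?_).trans ?_
    · rw [← mul_sub, ← Complex.sub_re, norm_mul]
      calc _ ≤ 1 * ‖deriv g (squeeze z t) - deriv g (squeeze w t)‖ := by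
            gcongr
            · exact Real.abs_cos_le_one t
            · exact Complex.abs_re_le_norm _
        _ ≤ 128 * a / ρ * ‖squeeze z t - squeeze w t‖ := by
            rw [one_mul]
            exact hLd _ (squeeze_mem_ball hz t) _ (squeeze_mem_ball hw t)
        _ ≤ _ := by
            rw [← squeeze_sub]
            gcongr
            exact norm_squeeze_le _ _
    · have : |Real.pi / 2 - 0| ≤ 2 := by
        rw [sub_zero, abs_of_pos (by positivity)]; linarith [Real.pi_le_four]
      calc _ ≤ 128 * a / ρ * ‖z - w‖ * 2 := by gcongr
        _ = _ := by ring
  have hq0 : |imQuot g 0| = a := by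
    rw [imQuot_zero, ha, ← Complex.abs_re_eq_norm.2 (deriv_im_eq_zero hR hg hreal)]
  have h0mem : (0 : ℂ) ∈ ball (0 : ℂ) (ρ / 4) := mem_ball_self (by positivity)
  have hapos : 0 < a := by
    refine lt_of_le_of_ne' (ha ▸ norm_nonneg _) fun ha0 ↦ ?_
    -- the quotient would vanish near `0`, hence so would `Im g`
    have hz : (ρ / 8 * Complex.I : ℂ) ∈ ball (0 : ℂ) (ρ / 4) := by
      rw [mem_ball_zero_iff]
      simp only [norm_mul, norm_div, Complex.norm_real, Complex.norm_I, Real.norm_of_nonneg hρ.le]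
      norm_num
      linarith
    have hz' := ball_subset_ball (by linarith : ρ / 4 ≤ 2 * ρ) hz
    have h1 := hLq _ hz 0 h0mem
    have h2 : imQuot g 0 = 0 := by rw [← abs_eq_zero, hq0, ha0]
    rw [ha0, h2] at h1
    have h3 : imQuot g (ρ / 8 * Complex.I) = 0 := by simpa using h1
    have h4 := im_eq_imQuot_mul_im hg hreal hz'
    rw [h3, zero_mul, hzero _ hz'] at h4
    simp [hρ.ne'] at h4
  refine ⟨(contDiffOn_imQuot hg).mono (ball_subset_ball (by linarith)), fun z hz ↦ ?_⟩
  have hz4 := ball_subset_ball (by linarith : ρ / 512 ≤ ρ / 4) hz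
  have hlow : a / 2 ≤ |imQuot g z| := by
    have h1 := hLq z hz4 0 h0mem
    rw [sub_zero] at h1
    rw [mem_ball_zero_iff] at hz
    have h2 : 256 * a / ρ * ‖z‖ ≤ a / 2 := by
      calc _ ≤ 256 * a / ρ * (ρ / 512) := by gcongr
        _ = _ := by field_simp; norm_num
    have h3 := abs_sub_abs_le_abs_sub (imQuot g 0) (imQuot g z)
    rw [abs_sub_comm, hq0] at h3
    linarith
  refine ⟨im_eq_imQuot_mul_im hg hreal (ball_subset_ball (by linarith) hz),
    abs_pos.1 (by linarith), ?_⟩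
  have h1 : ‖fderiv ℝ (imQuot g) z‖ ≤ 256 * a / ρ := by
    refine norm_fderiv_le_of_lip' ℝ (by positivity) ?_
    filter_upwards [isOpen_ball.mem_nhds hz4] with w hw
    exact hLq w hw z hz4
  calc _ ≤ 256 * a / ρ := h1
    _ = 512 / ρ * (a / 2) := by ring
    _ ≤ _ := by gcongr

/-! ### Functions that are real on equally spaced rays -/

/-- A holomorphic function that is real wherever `t ^ k` is real is a function of `t ^ k`: the
reflections in two adjacent rays compose to the rotation by `2 π / k`, which leaves it invariant. -/
theorem exists_comp_pow {H : ℂ → ℂ} {R : ℝ} (hR : 0 < R) {k : ℕ} (hk : k ≠ 0)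
    (hH : DifferentiableOn ℂ H (ball 0 R))
    (hreal : ∀ t ∈ ball (0 : ℂ) R, (t ^ k).im = 0 → (H t).im = 0) :
    ∃ g : ℂ → ℂ, DifferentiableOn ℂ g (ball 0 (R ^ k)) ∧ ∀ t ∈ ball (0 : ℂ) R, g (t ^ k) = H t := by
  have : NeZero k := ⟨hk⟩
  set η : ℂ := Complex.exp (Real.pi * Complex.I / k) with hη
  have hkC : (k : ℂ) ≠ 0 := Nat.cast_ne_zero.2 hk
  have hηk : η ^ k = -1 := by
    rw [hη, ← Complex.exp_nat_mul, mul_div_cancel₀ _ hkC, Complex.exp_pi_mul_I]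
  have hη1 : ‖η‖ = 1 := by
    have : η = Complex.exp ((Real.pi / k : ℝ) * Complex.I) := by
      rw [hη]; push_cast; ring_nf
    rw [this, Complex.norm_exp_ofReal_mul_I]
  have hηball : ∀ t ∈ ball (0 : ℂ) R, η * t ∈ ball (0 : ℂ) R := fun t ht ↦ by
    rw [mem_ball_zero_iff] at *; rwa [norm_mul, hη1, one_mul]
  have hpow_im : ∀ t : ℂ, t.im = 0 → (t ^ k).im = 0 := fun t ht ↦ by
    have : t = (t.re : ℂ) := Complex.ext rfl (by simpa using ht)
    rw [this, ← Complex.ofReal_pow, Complex.ofReal_im]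
  have hs1 : ∀ t ∈ ball (0 : ℂ) R, (starRingEnd ℂ) (H ((starRingEnd ℂ) t)) = H t := fun t ht ↦
    conj_apply_conj hR hH (fun z hz h ↦ hreal z hz (hpow_im z h)) ht
  have hs2 : ∀ t ∈ ball (0 : ℂ) R,
      (starRingEnd ℂ) (H (η * (starRingEnd ℂ) t)) = H (η * t) := fun t ht ↦ by
    refine conj_apply_conj (g := fun t ↦ H (η * t)) hR
      (hH.comp (by fun_prop) hηball) (fun z hz h ↦ hreal _ (hηball z hz) ?_) ht
    rw [mul_pow, hηk, neg_one_mul, Complex.neg_im, hpow_im z h, neg_zero]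
  have hηconj : (starRingEnd ℂ) η * η = 1 := by
    rw [mul_comm, Complex.mul_conj, Complex.normSq_eq_norm_sq, hη1]; simp
  -- composing the reflections in two adjacent rays gives the rotation by `η ^ 2`
  have hrot : ∀ t ∈ ball (0 : ℂ) R, H (η ^ 2 * t) = H t := by
    intro t ht
    have h1 := hs2 _ (hηball t ht)
    have h2 := hs1 t ht
    rw [map_mul, ← mul_assoc, mul_comm η, hηconj, one_mul, h2, ← mul_assoc, ← sq] at h1
    exact h1.symm
  have hrot' : ∀ j : ℕ, ∀ t ∈ ball (0 : ℂ) R, H ((η ^ 2) ^ j * t) = H t := by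
    intro j
    induction j with
    | zero => simp
    | succ j ih =>
      intro t ht
      rw [pow_succ, mul_assoc, ih _ (by rw [sq, mul_assoc]; exact hηball _ (hηball _ ht)),
        hrot t ht]
  have hprim : IsPrimitiveRoot (η ^ 2) k := by
    have h := Complex.isPrimitiveRoot_exp k hk
    have : η ^ 2 = Complex.exp (2 * Real.pi * Complex.I / k) := by
      rw [hη, ← Complex.exp_nat_mul]; push_cast; ring_nf
    rwa [this]
  have hfib : ∀ s t : ℂ, t ∈ ball (0 : ℂ) R → s ^ k = t ^ k → H s = H t := by
    intro s t ht hst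
    rcases eq_or_ne t 0 with rfl | h0
    · rw [zero_pow hk, pow_eq_zero_iff hk] at hst
      rw [hst]
    · obtain ⟨j, -, hj⟩ := hprim.eq_pow_of_pow_eq_one (ξ := s / t)
        (by rw [div_pow, hst, div_self (pow_ne_zero k h0)])
      rw [← hrot' j t ht, hj, div_mul_cancel₀ _ h0]
  have hroot : ∀ ζ ∈ ball (0 : ℂ) (R ^ k), ∀ s : ℂ, s ^ k = ζ → s ∈ ball (0 : ℂ) R := by
    intro ζ hζ s hs
    rw [mem_ball_zero_iff, ← hs, norm_pow] at hζ
    rw [mem_ball_zero_iff]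
    exact lt_of_pow_lt_pow_left₀ k hR.le hζ
  set g : ℂ → ℂ := fun ζ ↦ H (ζ ^ ((k : ℂ)⁻¹)) with hgdef
  have hgt : ∀ t ∈ ball (0 : ℂ) R, g (t ^ k) = H t := fun t ht ↦
    hfib _ t ht (Complex.cpow_nat_inv_pow _ hk)
  have hdiff : ∀ ζ ∈ ball (0 : ℂ) (R ^ k), ζ ≠ 0 → DifferentiableAt ℂ g ζ := by
    intro ζ hζ h0
    by_cases hs : ζ ∈ Complex.slitPlane
    · have h1 : DifferentiableAt ℂ (fun ζ : ℂ ↦ ζ ^ ((k : ℂ)⁻¹)) ζ :=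
        (differentiableAt_id.cpow_const hs)
      exact (hH.differentiableAt (isOpen_ball.mem_nhds
        (hroot ζ hζ _ (Complex.cpow_nat_inv_pow _ hk)))).comp ζ h1
    · -- on the cut the branch `η * (-ζ) ^ (1 / k)` is used instead
      have hs' : -ζ ∈ Complex.slitPlane := by
        rw [Complex.mem_slitPlane_iff] at hs ⊢
        push Not at hs
        refine Or.inl ?_
        rw [Complex.neg_re, neg_pos]
        refine hs.1.lt_of_ne fun h ↦ h0 (Complex.ext h hs.2)
      have hb : ∀ ζ : ℂ, (η * (-ζ) ^ ((k : ℂ)⁻¹)) ^ k = ζ := fun ζ ↦ by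
        rw [mul_pow, hηk, Complex.cpow_nat_inv_pow _ hk]; ring
      have h1 : DifferentiableAt ℂ (fun ζ : ℂ ↦ η * (-ζ) ^ ((k : ℂ)⁻¹)) ζ :=
        (differentiableAt_id.neg.cpow_const hs').const_mul η
      have h2 : DifferentiableAt ℂ (fun ζ : ℂ ↦ H (η * (-ζ) ^ ((k : ℂ)⁻¹))) ζ :=
        (hH.differentiableAt (isOpen_ball.mem_nhds (hroot ζ hζ _ (hb ζ)))).comp ζ h1
      refine h2.congr_of_eventuallyEq ?_
      filter_upwards [isOpen_ball.mem_nhds hζ] with w hw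
      exact hfib _ _ (hroot w hw _ (hb w)) (by rw [hb, Complex.cpow_nat_inv_pow _ hk])
  refine ⟨g, fun ζ hζ ↦ ?_, hgt⟩
  rcases eq_or_ne ζ 0 with rfl | h0
  · refine (Complex.analyticAt_of_differentiable_on_punctured_nhds_of_continuousAt ?_
      ?_).differentiableAt.differentiableWithinAt
    · filter_upwards [self_mem_nhdsWithin, nhdsWithin_le_nhds (isOpen_ball.mem_nhds hζ)]
        with w hw hw'
      exact hdiff w hw' hw
    · have h00 : (0 : ℂ) ^ ((k : ℂ)⁻¹) = 0 := Complex.zero_cpow (inv_ne_zero hkC)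
      refine ContinuousAt.comp (f := fun ζ : ℂ ↦ ζ ^ ((k : ℂ)⁻¹)) (g := H) ?_ ?_
      · rw [h00]
        exact hH.continuousOn.continuousAt (ball_mem_nhds _ hR)
      · rw [ContinuousAt, h00, tendsto_zero_iff_norm_tendsto_zero]
        rw [Metric.tendsto_nhds]
        intro ε hε
        filter_upwards [ball_mem_nhds (0 : ℂ) (pow_pos hε k)] with w hw
        have h3 : ‖w ^ ((k : ℂ)⁻¹)‖ ^ k < ε ^ k := by
          rw [← norm_pow, Complex.cpow_nat_inv_pow _ hk]
          simpa using hw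
        rw [dist_zero_right, norm_norm]
        exact lt_of_pow_lt_pow_left₀ k hε.le h3
  · exact (hdiff ζ hζ h0).differentiableWithinAt

/-! ### Local coordinates at a zero -/

/-- A nonconstant holomorphic function is `φ ^ k` near a zero, for a local coordinate `φ` with
inverse `ψ`. -/
theorem exists_pow_coordinate {F : ℂ → ℂ} {z₀ : ℂ} (hF : AnalyticAt ℂ F z₀) (h0 : F z₀ = 0)
    (hne : ¬ ∀ᶠ z in 𝓝 z₀, F z = 0) :
    ∃ k : ℕ, k ≠ 0 ∧ ∃ φ ψ : ℂ → ℂ, AnalyticAt ℂ φ z₀ ∧ φ z₀ = 0 ∧ AnalyticAt ℂ ψ 0 ∧ ψ 0 = z₀ ∧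
      (∀ᶠ z in 𝓝 z₀, F z = φ z ^ k) ∧ (∀ᶠ t in 𝓝 0, φ (ψ t) = t) ∧
      ∀ᶠ z in 𝓝 z₀, ψ (φ z) = z := by
  obtain ⟨k, G, hG, hG0, hFG⟩ := hF.exists_eventuallyEq_pow_smul_nonzero_iff.2 hne
  have hk : k ≠ 0 := by
    rintro rfl
    have := hFG.self_of_nhds
    simp [h0] at this
    exact hG0 this.symm
  set c : ℂ := G z₀ ^ ((k : ℂ)⁻¹) with hc
  have hck : c ^ k = G z₀ := Complex.cpow_nat_inv_pow _ hk
  have hc0 : c ≠ 0 := by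
    intro h
    rw [h, zero_pow hk] at hck
    exact hG0 hck.symm
  set b : ℂ → ℂ := fun z ↦ c * (G z / G z₀) ^ ((k : ℂ)⁻¹) with hb
  have hban : AnalyticAt ℂ b z₀ := by
    refine analyticAt_const.mul (AnalyticAt.cpow (hG.div analyticAt_const hG0) analyticAt_const ?_)
    simp [hG0]
  have hbk : ∀ z, b z ^ k = G z := fun z ↦ by
    rw [hb, mul_pow, hck, Complex.cpow_nat_inv_pow _ hk, mul_div_cancel₀ _ hG0]
  have hb0 : b z₀ ≠ 0 := by
    intro h
    have := hbk z₀
    rw [h, zero_pow hk] at this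
    exact hG0 this.symm
  set φ : ℂ → ℂ := fun z ↦ (z - z₀) * b z with hφ
  have hφan : AnalyticAt ℂ φ z₀ := (analyticAt_id.sub analyticAt_const).mul hban
  have hφ0 : φ z₀ = 0 := by simp [hφ]
  have hφd : deriv φ z₀ ≠ 0 := by
    have h1 := ((hasDerivAt_id z₀).sub_const z₀).mul hban.differentiableAt.hasDerivAt
    have h2 : deriv φ z₀ = b z₀ := by
      refine HasDerivAt.deriv ?_
      convert! h1 using 1
      simp
    rwa [h2]
  refine ⟨k, hk, φ, hφan.hasStrictDerivAt.localInverse _ _ _ hφd, hφan, hφ0, ?_, ?_, ?_, ?_, ?_⟩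
  · have := hφan.analyticAt_localInverse hφd
    rwa [hφ0] at this
  · have : hφan.hasStrictDerivAt.localInverse _ _ _ hφd (φ z₀) = z₀ :=
      HasStrictFDerivAt.localInverse_apply_image ..
    rwa [hφ0] at this
  · filter_upwards [hFG] with z hz
    rw [hz, hφ, mul_pow, hbk, smul_eq_mul]
  · have := HasStrictDerivAt.eventually_right_inverse hφan.hasStrictDerivAt hφd
    rwa [hφ0] at this
  · exact HasStrictDerivAt.eventually_left_inverse hφan.hasStrictDerivAt hφd

/-! ### Local factors of the functions with a given zero set -/

theorem exists_im_eq {Z : Set ℂ} {u : ℂ → ℝ} (hu : u ∈ HarmonicWithZeros Z) :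
    ∃ H : ℂ → ℂ, AnalyticOnNhd ℂ H (ball 0 2) ∧ ∀ z ∈ ball (0 : ℂ) 2, (H z).im = u z := by
  obtain ⟨F, hF, hFu⟩ := hu.1.exists_analyticOnNhd_ball_re_eq
  exact ⟨fun z ↦ Complex.I * F z, fun z hz ↦ analyticAt_const.mul (hF z hz),
    fun z hz ↦ by simpa using hFu hz⟩

theorem eq_zero_iff_mem {Z : Set ℂ} {u : ℂ → ℝ} (hu : u ∈ HarmonicWithZeros Z) {z : ℂ}
    (hz : z ∈ ball (0 : ℂ) 2) : u z = 0 ↔ z ∈ Z := by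
  rw [← hu.2]
  exact ⟨fun h ↦ ⟨hz, h⟩, fun h ↦ h.2⟩

theorem norm_deriv_le_of_re_nonneg {G : ℂ → ℂ} {R : ℝ} (hR : 0 < R)
    (hG : DifferentiableOn ℂ G (ball 0 R)) (hre : ∀ z ∈ ball 0 R, 0 ≤ (G z).re) :
    ‖deriv G 0‖ ≤ 12 / R * ‖G 0‖ := by
  have h := Complex.norm_deriv_le_of_forall_mem_sphere_norm_le (c := 0) (R := R / 4)
    (C := 3 * ‖G 0‖) (f := G) (by positivity) ?_ ?_
  · refine h.trans_eq ?_
    field_simp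
    ring
  · refine (hG.mono (closure_ball_subset_closedBall.trans ?_)).diffContOnCl
    exact closedBall_subset_ball (by linarith)
  · intro z hz
    rw [mem_sphere_zero_iff_norm] at hz
    exact norm_le_three_mul_of_re_nonneg hR hG hre (by linarith)

/-- The gradient form of Harnack's inequality, for the harmonic function `Im H`. -/
theorem norm_deriv_le_of_im_ne_zero {H : ℂ → ℂ} {z : ℂ} {R : ℝ} (hR : 0 < R)
    (hH : DifferentiableOn ℂ H (ball z R)) (him : ∀ w ∈ ball z R, (H w).im ≠ 0) :
    ‖deriv H z‖ ≤ 12 / R * |(H z).im| := by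
  have key : ∀ c : ℂ, ‖c‖ = 1 → (∀ w ∈ ball z R, 0 ≤ (c * (H w - (H z).re)).re) →
      ‖deriv H z‖ ≤ 12 / R * |(H z).im| := by
    intro c hc hpos
    have hmem : ∀ w ∈ ball (0 : ℂ) R, z + w ∈ ball z R := fun w hw ↦ by simpa using hw
    have hd : HasDerivAt (fun w ↦ c * (H (z + w) - (H z).re)) (c * deriv H z) 0 := by
      have h1 : HasDerivAt H (deriv H z) (z + 0) := by
        rw [add_zero]
        exact (hH.differentiableAt (ball_mem_nhds _ hR)).hasDerivAt
      have h2 := h1.comp_const_add z 0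
      exact (h2.sub_const _).const_mul c
    have h := norm_deriv_le_of_re_nonneg (G := fun w ↦ c * (H (z + w) - (H z).re)) hR
      (((hH.comp (by fun_prop) hmem).sub_const _).const_mul c) (fun w hw ↦ hpos _ (hmem w hw))
    rw [hd.deriv, norm_mul, hc, one_mul, norm_mul, hc, one_mul, add_zero] at h
    have h3 : H z - ((H z).re : ℂ) = (H z).im * Complex.I := by
      apply Complex.ext <;> simp
    rw [h3, norm_mul, Complex.norm_I, mul_one, Complex.norm_real] at h
    exact h
  have hcont : ContinuousOn (fun w ↦ (H w).im) (ball z R) :=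
    Complex.continuous_im.comp_continuousOn hH.continuousOn
  have hpre := (convex_ball z R).isPreconnected
  have hz := mem_ball_self (x := z) hR
  rcases (him z hz).lt_or_gt with hneg | hpos
  · refine key Complex.I (by simp) fun w hw ↦ ?_
    have : (H w).im ≤ 0 := by
      by_contra! h
      obtain ⟨x, hx, hx0⟩ := hpre.intermediate_value hz hw hcont ⟨hneg.le, h.le⟩
      exact him x hx hx0
    simpa using this
  · refine key (-Complex.I) (by simp) fun w hw ↦ ?_
    have : 0 ≤ (H w).im := by
      by_contra! h
      obtain ⟨x, hx, hx0⟩ := hpre.intermediate_value hw hz hcont ⟨h.le, hpos.le⟩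
      exact him x hx hx0
    simpa using this

/-- A complex derivative, seen as a real Fréchet derivative, has at most its own norm. -/
theorem exists_hasFDerivAt_norm_le {f : ℂ → ℂ} {z : ℂ} (hf : DifferentiableAt ℂ f z) :
    ∃ L : ℂ →L[ℝ] ℂ, HasFDerivAt f L z ∧ ‖L‖ ≤ ‖deriv f z‖ := by
  refine ⟨_, hf.hasDerivAt.hasFDerivAt.restrictScalars ℝ, ?_⟩
  rw [ContinuousLinearMap.norm_restrictScalars]
  simp

/-- On `B`, `u` is the product of `s` and of a smooth nonvanishing function `q` whose logarithmic
gradient is bounded by `C`. The functions of `HarmonicWithZeros Z` have such factors with `C`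
and `s` depending on `Z` only, and then the quotient of two of them is the quotient of their
factors. -/
structure IsLocalFactor (C : ℝ) (B : Set ℂ) (s u q : ℂ → ℝ) : Prop where
  contDiffOn : ContDiffOn ℝ ∞ q B
  eq_mul : ∀ z ∈ B, u z = q z * s z
  ne_zero : ∀ z ∈ B, q z ≠ 0
  norm_fderiv_le : ∀ z ∈ B, ‖fderiv ℝ q z‖ ≤ C * |q z|

/-- Off `Z` one takes `s = 1`, and the bound is Harnack's inequality. -/
theorem exists_local_factor_of_notMem {Z : Set ℂ} {u₀ : ℂ → ℝ} (hu₀ : u₀ ∈ HarmonicWithZeros Z)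
    {z₀ : ℂ} (hz₀ : z₀ ∈ ball (0 : ℂ) 2) (hz₀Z : z₀ ∉ Z) :
    ∃ r > 0, ∃ C : ℝ, ball z₀ r ⊆ ball (0 : ℂ) 2 ∧
      ∀ u ∈ HarmonicWithZeros Z, IsLocalFactor C (ball z₀ r) 1 u u := by
  have hev : ∀ᶠ z in 𝓝 z₀, z ∈ ball (0 : ℂ) 2 ∧ u₀ z ≠ 0 := by
    refine (isOpen_ball.eventually_mem hz₀).and ?_
    refine (hu₀.1.continuousOn.continuousAt (isOpen_ball.mem_nhds hz₀)).eventually_ne ?_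
    rwa [Ne, eq_zero_iff_mem hu₀ hz₀]
  obtain ⟨R, hR, hball⟩ := Metric.eventually_nhds_iff_ball.1 hev
  refine ⟨R / 2, by positivity, 12 / (R / 2),
    fun z hz ↦ (hball z (ball_subset_ball (by linarith) hz)).1, fun u hu ↦ ?_⟩
  obtain ⟨H, hH, hHu⟩ := exists_im_eq hu
  have hsub : ball z₀ (R / 2) ⊆ ball (0 : ℂ) 2 :=
    fun z hz ↦ (hball z (ball_subset_ball (by linarith) hz)).1
  have hne : ∀ z ∈ ball z₀ R, (H z).im ≠ 0 := fun z hz ↦ by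
    rw [hHu z (hball z hz).1, Ne, eq_zero_iff_mem hu (hball z hz).1,
      ← eq_zero_iff_mem hu₀ (hball z hz).1]
    exact (hball z hz).2
  refine ⟨?_, fun z _ ↦ by simp, fun z hz ↦ ?_, fun z hz ↦ ?_⟩
  · have h1 : ContDiffOn ℝ ∞ H (ball 0 2) :=
      (hH.differentiableOn.contDiffOn isOpen_ball).restrict_scalars ℝ
    exact (Complex.imCLM.contDiff.comp_contDiffOn (h1.mono hsub)).congr
      fun z hz ↦ (hHu z (hsub hz)).symm
  · rw [← hHu z (hsub hz)]
    exact hne z (ball_subset_ball (by linarith) hz)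
  · have hzR : ball z (R / 2) ⊆ ball z₀ R := by
      refine ball_subset_ball' ?_
      rw [mem_ball] at hz
      linarith
    have h1 := norm_deriv_le_of_im_ne_zero (by positivity : 0 < R / 2)
      (hH.differentiableOn.mono (hzR.trans fun w hw ↦ (hball w hw).1)) (fun w hw ↦ hne w (hzR hw))
    obtain ⟨L, hL, hLn⟩ := exists_hasFDerivAt_norm_le (hH z (hsub hz)).differentiableAt
    have h2 : HasFDerivAt u (Complex.imCLM.comp L) z := by
      refine (Complex.imCLM.hasFDerivAt.comp z hL).congr_of_eventuallyEq ?_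
      filter_upwards [isOpen_ball.mem_nhds (hsub hz)] with w hw
      exact (hHu w hw).symm
    rw [h2.fderiv, ← hHu z (hsub hz)]
    calc _ ≤ ‖Complex.imCLM‖ * ‖L‖ := ContinuousLinearMap.opNorm_comp_le _ _
      _ ≤ 1 * ‖deriv H z‖ := by rw [Complex.imCLM_norm]; gcongr
      _ ≤ _ := by rwa [one_mul]

/-- At a point of `Z` one takes `s = u₀`. With `u₀ = Im F`, the other functions with zero set `Z` are
locally `Im (g ∘ F)` with `Im g` vanishing exactly on the real axis, so that the factor is
`imQuot g ∘ F`. -/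
theorem exists_local_factor_of_mem {Z : Set ℂ} {u₀ : ℂ → ℝ} (hu₀ : u₀ ∈ HarmonicWithZeros Z)
    (hZ : Z ≠ ball (0 : ℂ) 2) {z₀ : ℂ} (hz₀ : z₀ ∈ ball (0 : ℂ) 2) (hz₀Z : z₀ ∈ Z) :
    ∃ r > 0, ∃ C : ℝ, ball z₀ r ⊆ ball (0 : ℂ) 2 ∧
      ∀ u ∈ HarmonicWithZeros Z, ∃ q, IsLocalFactor C (ball z₀ r) u₀ u q := by
  obtain ⟨F₀, hF₀, hF₀u⟩ := exists_im_eq hu₀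
  set F : ℂ → ℂ := fun z ↦ F₀ z - F₀ z₀ with hFdef
  have hF : AnalyticOnNhd ℂ F (ball 0 2) := fun z hz ↦ (hF₀ z hz).sub analyticAt_const
  have hFu : ∀ z ∈ ball (0 : ℂ) 2, (F z).im = u₀ z := fun z hz ↦ by
    rw [hFdef, Complex.sub_im, hF₀u z hz, hF₀u z₀ hz₀, (eq_zero_iff_mem hu₀ hz₀).2 hz₀Z, sub_zero]
  have hFz : F z₀ = 0 := sub_self _
  have hFne : ¬ ∀ᶠ z in 𝓝 z₀, F z = 0 := fun h ↦ by
    have h1 := hF.eqOn_zero_of_preconnected_of_eventuallyEq_zero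
      (convex_ball _ _).isPreconnected hz₀ h
    refine hZ (hu₀.2 ▸ Set.ext fun z ↦ ⟨fun hz ↦ hz.1, fun hz ↦ ⟨hz, ?_⟩⟩)
    rw [← hFu z hz, h1 hz]
    simp
  obtain ⟨k, hk, φ, ψ, hφ, hφ0, hψ, hψ0, hFφ, hφψ, hψφ⟩ := exists_pow_coordinate (hF z₀ hz₀) hFz hFne
  -- the chart `ψ`, on a disk where it straightens `F` to `t ^ k`
  obtain ⟨R, hR, hRball⟩ : ∃ R > 0, ∀ t ∈ ball (0 : ℂ) R, DifferentiableAt ℂ ψ t ∧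
      ψ t ∈ ball (0 : ℂ) 2 ∧ F (ψ t) = t ^ k := by
    refine Metric.eventually_nhds_iff_ball.1 ?_
    have hcont : Tendsto ψ (𝓝 0) (𝓝 z₀) := by
      have := hψ.continuousAt.tendsto
      rwa [hψ0] at this
    filter_upwards [hψ.eventually_analyticAt, hcont.eventually (isOpen_ball.mem_nhds hz₀),
      hcont.eventually hFφ, hφψ] with t h1 h2 h3 h4
    exact ⟨h1.differentiableAt, h2, by rw [h3, h4]⟩
  obtain ⟨δ, hδ, C, hC⟩ := exists_imQuot_bound (pow_pos hR k)
  set M : ℝ := ‖deriv F z₀‖ + 1 with hM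
  obtain ⟨r, hr, hrball⟩ : ∃ r > 0, ∀ z ∈ ball z₀ r, z ∈ ball (0 : ℂ) 2 ∧ φ z ∈ ball (0 : ℂ) R ∧
      ψ (φ z) = z ∧ F z = φ z ^ k ∧ F z ∈ ball (0 : ℂ) δ ∧ ‖deriv F z‖ ≤ M := by
    refine Metric.eventually_nhds_iff_ball.1 ?_
    have h1 : Tendsto φ (𝓝 z₀) (𝓝 0) := by
      have := hφ.continuousAt.tendsto
      rwa [hφ0] at this
    have h2 : Tendsto F (𝓝 z₀) (𝓝 0) := by
      have := (hF z₀ hz₀).continuousAt.tendsto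
      rwa [hFz] at this
    have h3 : Tendsto (fun z ↦ ‖deriv F z‖) (𝓝 z₀) (𝓝 ‖deriv F z₀‖) :=
      (hF z₀ hz₀).deriv.continuousAt.norm
    filter_upwards [isOpen_ball.mem_nhds hz₀, h1.eventually (ball_mem_nhds _ hR), hψφ, hFφ,
      h2.eventually (ball_mem_nhds _ hδ), h3.eventually (Iic_mem_nhds (lt_add_one _))]
      with z a b c d e f
    exact ⟨a, b, c, d, e, f⟩
  refine ⟨r, hr, |C| * M, fun z hz ↦ (hrball z hz).1, fun u hu ↦ ?_⟩
  obtain ⟨H, hH, hHu⟩ := exists_im_eq hu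
  -- in the chart `ψ` the zero set of `u` is `{Im (t ^ k) = 0}`, so `H ∘ ψ` is a function of `t ^ k`
  have hHψ : DifferentiableOn ℂ (H ∘ ψ) (ball 0 R) := fun t ht ↦
    ((hH _ (hRball t ht).2.1).differentiableAt.comp t (hRball t ht).1).differentiableWithinAt
  have hzero : ∀ t ∈ ball (0 : ℂ) R, ((H ∘ ψ) t).im = 0 ↔ (t ^ k).im = 0 := fun t ht ↦ by
    obtain ⟨-, h2, h3⟩ := hRball t ht
    rw [Function.comp_apply, hHu _ h2, eq_zero_iff_mem hu h2, ← eq_zero_iff_mem hu₀ h2,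
      ← hFu _ h2, h3]
  obtain ⟨g, hg, hgH⟩ := exists_comp_pow hR hk hHψ fun t ht ↦ (hzero t ht).2
  have hgzero : ∀ ζ ∈ ball (0 : ℂ) (R ^ k), (g ζ).im = 0 ↔ ζ.im = 0 := by
    intro ζ hζ
    obtain ⟨t, rfl⟩ : ∃ t : ℂ, t ^ k = ζ := ⟨_, Complex.cpow_nat_inv_pow ζ hk⟩
    have ht : t ∈ ball (0 : ℂ) R := by
      rw [mem_ball_zero_iff, norm_pow] at hζ
      rw [mem_ball_zero_iff]
      exact lt_of_pow_lt_pow_left₀ k hR.le hζ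
    rw [hgH t ht, hzero t ht]
  obtain ⟨hsm, hq⟩ := hC g hg hgzero
  have hmaps : MapsTo F (ball z₀ r) (ball 0 δ) := fun z hz ↦ (hrball z hz).2.2.2.2.1
  refine ⟨imQuot g ∘ F, ?_, fun z hz ↦ ?_, fun z hz ↦ (hq _ (hmaps hz)).2.1, fun z hz ↦ ?_⟩
  · have h1 : ContDiffOn ℝ ∞ F (ball 0 2) :=
      (hF.differentiableOn.contDiffOn isOpen_ball).restrict_scalars ℝ
    exact hsm.comp (h1.mono fun z hz ↦ (hrball z hz).1) hmaps
  · obtain ⟨h2, hφR, hinv, hFk, -, -⟩ := hrball z hz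
    rw [Function.comp_apply, ← hFu z h2, ← (hq _ (hmaps hz)).1, hFk, hgH _ hφR,
      Function.comp_apply, hinv, hHu z h2]
  · obtain ⟨h2, -, -, -, -, hMz⟩ := hrball z hz
    obtain ⟨L, hL, hLn⟩ := exists_hasFDerivAt_norm_le (hF z h2).differentiableAt
    have hqd : HasFDerivAt (imQuot g) (fderiv ℝ (imQuot g) (F z)) (F z) :=
      ((hsm.contDiffAt (isOpen_ball.mem_nhds (hmaps hz))).differentiableAt
        (by simp)).hasFDerivAt
    rw [(hqd.comp z hL).fderiv]
    calc _ ≤ ‖fderiv ℝ (imQuot g) (F z)‖ * ‖L‖ := ContinuousLinearMap.opNorm_comp_le _ _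
      _ ≤ (|C| * |imQuot g (F z)|) * M := by
          gcongr
          · refine (hq _ (hmaps hz)).2.2.trans ?_
            gcongr
            exact le_abs_self C
          · exact hLn.trans hMz
      _ = _ := by rw [Function.comp_apply]; ring

theorem exists_local_factor {Z : Set ℂ} {u₀ : ℂ → ℝ} (hu₀ : u₀ ∈ HarmonicWithZeros Z)
    (hZ : Z ≠ ball (0 : ℂ) 2) {z₀ : ℂ} (hz₀ : z₀ ∈ ball (0 : ℂ) 2) :
    ∃ r > 0, ∃ C : ℝ, ∃ s : ℂ → ℝ, ball z₀ r ⊆ ball (0 : ℂ) 2 ∧ (∀ z ∈ ball z₀ r \ Z, s z ≠ 0) ∧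
      ∀ u ∈ HarmonicWithZeros Z, ∃ q, IsLocalFactor C (ball z₀ r) s u q := by
  by_cases h : z₀ ∈ Z
  · obtain ⟨r, hr, C, hsub, hq⟩ := exists_local_factor_of_mem hu₀ hZ hz₀ h
    exact ⟨r, hr, C, u₀, hsub, fun z hz ↦ (eq_zero_iff_mem hu₀ (hsub hz.1)).not.2 hz.2, hq⟩
  · obtain ⟨r, hr, C, hsub, hq⟩ := exists_local_factor_of_notMem hu₀ hz₀ h
    exact ⟨r, hr, C, 1, hsub, fun z _ ↦ one_ne_zero, fun u hu ↦ ⟨u, hq u hu⟩⟩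

/-! ### Gluing the local quotients -/

/-- The zero set of a harmonic function that is not identically zero has empty interior. -/
theorem nhdsWithin_compl_zeros_neBot {Z : Set ℂ} {u₀ : ℂ → ℝ} (hu₀ : u₀ ∈ HarmonicWithZeros Z)
    (hZ : Z ≠ ball (0 : ℂ) 2) {z : ℂ} (hz : z ∈ ball (0 : ℂ) 2) : (𝓝[Zᶜ] z).NeBot := by
  rw [← mem_closure_iff_nhdsWithin_neBot, closure_compl, mem_compl_iff, mem_interior_iff_mem_nhds]
  intro h
  have han : AnalyticOnNhd ℝ u₀ (ball 0 2) := fun w hw ↦ HarmonicAt.analyticAt (hu₀.1 w hw)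
  have h0 : u₀ =ᶠ[𝓝 z] 0 := by
    filter_upwards [h, isOpen_ball.mem_nhds hz] with w hw hw'
    exact (eq_zero_iff_mem hu₀ hw').2 hw
  have h1 := han.eqOn_zero_of_preconnected_of_eventuallyEq_zero
    (convex_ball _ _).isPreconnected hz h0
  exact hZ (hu₀.2 ▸ Set.ext fun w ↦ ⟨fun hw ↦ hw.1, fun hw ↦ ⟨hw, h1 hw⟩⟩)

theorem eq_of_eventuallyEq_off_zeros {Z : Set ℂ} {u₀ f g : ℂ → ℝ} (hu₀ : u₀ ∈ HarmonicWithZeros Z)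
    (hZ : Z ≠ ball (0 : ℂ) 2) {z : ℂ} (hz : z ∈ ball (0 : ℂ) 2) (hf : ContinuousAt f z)
    (hg : ContinuousAt g z) (hfg : f =ᶠ[𝓝[Zᶜ] z] g) : f z = g z := by
  have := nhdsWithin_compl_zeros_neBot hu₀ hZ hz
  exact tendsto_nhds_unique_of_eventuallyEq (hf.mono_left nhdsWithin_le_nhds)
    (hg.mono_left nhdsWithin_le_nhds) hfg

theorem IsLocalFactor.div_eq {Z B : Set ℂ} {C : ℝ} {s u v q p : ℂ → ℝ}
    (hu : IsLocalFactor C B s u q) (hv : IsLocalFactor C B s v p) (hs : ∀ z ∈ B \ Z, s z ≠ 0)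
    {z : ℂ} (hz : z ∈ B) (hzZ : z ∉ Z) : q z / p z = u z / v z := by
  rw [hu.eq_mul z hz, hv.eq_mul z hz, mul_div_mul_right _ _ (hs z ⟨hz, hzZ⟩)]

theorem IsLocalFactor.hasFDerivAt_log {B : Set ℂ} (hB : IsOpen B) {C : ℝ} {s u q : ℂ → ℝ}
    (hu : IsLocalFactor C B s u q) {z : ℂ} (hz : z ∈ B) :
    ∃ L : ℂ →L[ℝ] ℝ, HasFDerivAt (fun w ↦ Real.log (q w)) L z ∧ ‖L‖ ≤ C := by
  have hd : HasFDerivAt q (fderiv ℝ q z) z :=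
    ((hu.contDiffOn.contDiffAt (hB.mem_nhds hz)).differentiableAt (by simp)).hasFDerivAt
  refine ⟨_, hd.log (hu.ne_zero z hz), ?_⟩
  have h0 : 0 < |q z| := abs_pos.2 (hu.ne_zero z hz)
  rw [norm_smul, norm_inv, Real.norm_eq_abs, inv_mul_le_iff₀ h0, mul_comm]
  exact hu.norm_fderiv_le z hz

theorem exists_extension {Z : Set ℂ} (hZ : Z ≠ ball (0 : ℂ) 2) {u v : ℂ → ℝ}
    (hu : u ∈ HarmonicWithZeros Z) (hv : v ∈ HarmonicWithZeros Z) :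
    ∃ f, IsSmoothNonvanishingExtension Z u v f := by
  have hloc : ∀ z₀ ∈ ball (0 : ℂ) 2, ∃ r > 0, ∃ h : ℂ → ℝ, ball z₀ r ⊆ ball (0 : ℂ) 2 ∧
      ContDiffOn ℝ ∞ h (ball z₀ r) ∧ (∀ z ∈ ball z₀ r, h z ≠ 0) ∧
      ∀ z ∈ ball z₀ r, z ∉ Z → h z = u z / v z := by
    intro z₀ hz₀
    obtain ⟨r, hr, C, s, hsub, hs, hq⟩ := exists_local_factor hu hZ hz₀
    obtain ⟨q, hq'⟩ := hq u hu
    obtain ⟨p, hp⟩ := hq v hv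
    exact ⟨r, hr, fun z ↦ q z / p z, hsub, hq'.contDiffOn.div hp.contDiffOn hp.ne_zero,
      fun z hz ↦ div_ne_zero (hq'.ne_zero z hz) (hp.ne_zero z hz),
      fun z hz hzZ ↦ hq'.div_eq hp hs hz hzZ⟩
  choose! r hr h hsub hsm hne heq using hloc
  have hself : ∀ z ∈ ball (0 : ℂ) 2, z ∈ ball z (r z) := fun z hz ↦ mem_ball_self (hr z hz)
  have key : ∀ z₀ ∈ ball (0 : ℂ) 2, ∀ w ∈ ball z₀ (r z₀), h w w = h z₀ w := by
    intro z₀ hz₀ w hw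
    have hw2 := hsub z₀ hz₀ hw
    have hn1 : ball w (r w) ∈ 𝓝 w := isOpen_ball.mem_nhds (hself w hw2)
    have hn2 : ball z₀ (r z₀) ∈ 𝓝 w := isOpen_ball.mem_nhds hw
    refine eq_of_eventuallyEq_off_zeros hu hZ hw2 ((hsm w hw2).continuousOn.continuousAt hn1)
      ((hsm z₀ hz₀).continuousOn.continuousAt hn2) ?_
    filter_upwards [nhdsWithin_le_nhds hn1, nhdsWithin_le_nhds hn2, self_mem_nhdsWithin]
      with x hx1 hx2 hx3
    rw [heq w hw2 x hx1 hx3, heq z₀ hz₀ x hx2 hx3]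
  -- `h z` is the local extension near `z`, and the global one takes the value `h z z` at `z`
  refine ⟨fun z ↦ h z z, fun z hz ↦ ?_, fun z hz ↦ hne z hz z (hself z hz),
    fun z hz ↦ heq z hz.1 z (hself z hz.1) hz.2⟩
  have hn : ball z (r z) ∈ 𝓝 z := isOpen_ball.mem_nhds (hself z hz)
  refine (((hsm z hz).contDiffAt hn).congr_of_eventuallyEq ?_).contDiffWithinAt
  filter_upwards [hn] with w hw
  exact key z hz w hw

theorem exists_gradient_bound_nhds {Z : Set ℂ} (hZ : Z ≠ ball (0 : ℂ) 2) {u₀ : ℂ → ℝ}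
    (hu₀ : u₀ ∈ HarmonicWithZeros Z) {z₀ : ℂ} (hz₀ : z₀ ∈ ball (0 : ℂ) 2) :
    ∃ r > 0, ∃ C : ℝ, ∀ z ∈ ball z₀ r, ∀ u ∈ HarmonicWithZeros Z, ∀ v ∈ HarmonicWithZeros Z,
      ∀ f, IsSmoothNonvanishingExtension Z u v f →
        ‖∇ (fun w : ℂ ↦ Real.log |f w|) z‖ ≤ C := by
  obtain ⟨r, hr, C, s, hsub, hs, hq⟩ := exists_local_factor hu₀ hZ hz₀
  refine ⟨r, hr, 2 * C, fun z hz u hu v hv f hf ↦ ?_⟩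
  obtain ⟨q, hqu⟩ := hq u hu
  obtain ⟨p, hpv⟩ := hq v hv
  have hfqp : ∀ w ∈ ball z₀ r, f w = q w / p w := by
    intro w hw
    have hn : ball z₀ r ∈ 𝓝 w := isOpen_ball.mem_nhds hw
    refine eq_of_eventuallyEq_off_zeros (g := fun w ↦ q w / p w) hu₀ hZ (hsub hw)
      (hf.smooth.continuousOn.continuousAt (isOpen_ball.mem_nhds (hsub hw)))
      ((hqu.contDiffOn.continuousOn.continuousAt hn).div
        (hpv.contDiffOn.continuousOn.continuousAt hn) (hpv.ne_zero w hw)) ?_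
    filter_upwards [nhdsWithin_le_nhds hn, self_mem_nhdsWithin] with x hx hxZ
    rw [hf.eq_div x ⟨hsub hx, hxZ⟩, hqu.div_eq hpv hs hx hxZ]
  obtain ⟨L₁, hL₁, hn₁⟩ := hqu.hasFDerivAt_log isOpen_ball hz
  obtain ⟨L₂, hL₂, hn₂⟩ := hpv.hasFDerivAt_log isOpen_ball hz
  have hL : HasFDerivAt (fun w : ℂ ↦ Real.log |f w|) (L₁ - L₂) z := by
    refine (hL₁.sub hL₂).congr_of_eventuallyEq ?_
    filter_upwards [isOpen_ball.mem_nhds hz] with w hw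
    rw [Real.log_abs, hfqp w hw, Real.log_div (hqu.ne_zero w hw) (hpv.ne_zero w hw)]
    rfl
  rw [gradient, LinearIsometryEquiv.norm_map, hL.fderiv]
  linarith [norm_sub_le L₁ L₂]

end HarmonicRatio

open HarmonicRatio in
theorem theorem1 (Z : Set ℂ) (hZ : Z ⊆ Metric.ball (0 : ℂ) 2) :
    ∃ C : ℝ, 0 < C ∧ ∀ u ∈ HarmonicWithZeros Z, ∀ v ∈ HarmonicWithZeros Z,
      ∃ f : ℂ → ℝ, IsSmoothNonvanishingExtension Z u v f ∧
        ∀ z ∈ Metric.ball (0 : ℂ) 1, ‖∇ (fun w : ℂ => Real.log |f w|) z‖ ≤ C := by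
  rcases eq_or_ne Z (Metric.ball (0 : ℂ) 2) with rfl | hZne
  · -- only the zero function vanishes everywhere, and `f = 1` extends the empty quotient
    refine ⟨1, one_pos, fun u _ v _ ↦ ⟨fun _ ↦ 1, ⟨contDiffOn_const, fun _ _ ↦ one_ne_zero,
      fun z hz ↦ absurd hz.1 hz.2⟩, fun z _ ↦ ?_⟩⟩
    simp [gradient]
  rcases (HarmonicWithZeros Z).eq_empty_or_nonempty with hempty | ⟨u₀, hu₀⟩
  · exact ⟨1, one_pos, fun u hu ↦ by simp [hempty] at hu⟩
  obtain ⟨C, hC⟩ : ∃ C : ℝ, ∀ z ∈ Metric.closedBall (0 : ℂ) 1, ∀ u ∈ HarmonicWithZeros Z,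
      ∀ v ∈ HarmonicWithZeros Z, ∀ f, IsSmoothNonvanishingExtension Z u v f →
        ‖∇ (fun w : ℂ ↦ Real.log |f w|) z‖ ≤ C := by
    refine (isCompact_closedBall (0 : ℂ) 1).induction_on
      (p := fun S ↦ ∃ C : ℝ, ∀ z ∈ S, ∀ u ∈ HarmonicWithZeros Z,
        ∀ v ∈ HarmonicWithZeros Z, ∀ f, IsSmoothNonvanishingExtension Z u v f →
          ‖∇ (fun w : ℂ ↦ Real.log |f w|) z‖ ≤ C) ⟨0, by simp⟩ ?_ ?_ ?_
    · rintro S T hST ⟨C, hC⟩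
      exact ⟨C, fun z hz ↦ hC z (hST hz)⟩
    · rintro S T ⟨C, hC⟩ ⟨D, hD⟩
      refine ⟨max C D, fun z hz u hu v hv f hf ↦ ?_⟩
      rcases hz with hz | hz
      · exact (hC z hz u hu v hv f hf).trans (le_max_left _ _)
      · exact (hD z hz u hu v hv f hf).trans (le_max_right _ _)
    · intro z hz
      obtain ⟨r, hr, C, hC⟩ := exists_gradient_bound_nhds hZne hu₀
        (Metric.closedBall_subset_ball one_lt_two hz)
      exact ⟨_, mem_nhdsWithin_of_mem_nhds (Metric.ball_mem_nhds z hr), C, hC⟩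
  refine ⟨max C 1, by positivity, fun u hu v hv ↦ ?_⟩
  obtain ⟨f, hf⟩ := exists_extension hZne hu hv
  exact ⟨f, hf, fun z hz ↦ (hC z (Metric.ball_subset_closedBall hz) u hu v hv f hf).trans
    (le_max_left _ _)⟩
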